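/- Let $\varphi\colon (R,\mathfrak m)\to (S,\mathfrak n)$ be a local homomorphism of commutative noetherian local rings (that is, $\varphi(\mathfrak m)\subseteq\mathfrak n$), and let $N$ be a nonzero finitely generated $S$-module, regarded as an $R$-module through $\varphi$. If the injective dimension $\operatorname{id}_R N$ of $N$ over $R$ is finite, then $$\operatorname{id}_R N=\operatorname{depth} R,$$ where $\operatorname{depth} R$ is the supremum of the lengths of the $R$-regular sequences contained in $\mathfrak m$. -/

import Mathlib

universe u v w

/-- The depth of a (noetherian) local ring `R`: the supremum of the lengths of the `R`-regular
sequences contained in the maximal ideal of `R`. -/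
noncomputable def localRingDepth (R : Type u) [CommRing R] [IsLocalRing R] : ℕ∞ :=
  ⨆ (rs : List R) (_ : (∀ r ∈ rs, r ∈ IsLocalRing.maximalIdeal R) ∧
    RingTheory.Sequence.IsRegular R rs), (rs.length : ℕ∞)

/-- The injective dimension of a module `N` over a ring `R`, with value `⊥` exactly when `N = 0`
and `⊤` when it is infinite. The module is lifted to a universe that contains `R`, so that the
category of modules in which the injective dimension is taken is large enough
for all universe levels. -/
noncomputable def moduleInjDim (R : Type u) [CommRing R] (N : Type w) [AddCommGroup N]
    [Module R N] : WithBot ℕ∞ :=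
  CategoryTheory.injectiveDimension (ModuleCat.of R (ULift.{u} N))

open CategoryTheory Abelian IsLocalRing RingTheory.Sequence

/-! ### Finiteness of Ext over `S` and Nakayama's lemma -/

section ExtModule

variable {R : Type u} {S : Type w} {N : Type v} [CommRing R] [CommRing S] [Algebra R S]
  [AddCommGroup N] [Module R N] [Module S N] [IsScalarTower R S N]

/-! For `M` finite over `R`, Ext(M, N) is finite over `S`, so Nakayama works over `S` although `N`
need not be finite over `R`: killing an `M`-regular element of the maximal ideal moves nonvanishing
Ext up one degree (`nontrivial_ext_quotSMulTop`). Starting from Hom(R, N) ≠ 0, every regular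
sequence has length at most d = id N. Conversely, for a maximal regular sequence `rs` the residue
field k embeds in R/(rs), whose projective dimension is the length of `rs`. If that were below d,
then Ext^d(k, N) would vanish, hence, by prime filtrations and Nakayama, so would Ext^d(M, N) for
all finite `M`, forcing id N < d. -/

lemma Module.Finite.linearMap_of_isNoetherian [IsNoetherianRing S] [Module.Finite S N]
    (M : Type*) [AddCommGroup M] [Module R M] [Module.Finite R M] :
    Module.Finite S (M →ₗ[R] N) := by
  obtain ⟨n, g, hg⟩ := Module.Finite.exists_fin (R := R) (M := M)
  let ev : (M →ₗ[R] N) →ₗ[S] (Fin n → N) :=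
    { toFun f i := f (g i)
      map_add' _ _ := rfl
      map_smul' _ _ := rfl }
  refine Module.Finite.of_injective ev fun f f' h ↦ ?_
  refine LinearMap.ext_on_range hg fun i ↦ congrFun h i

variable [Small.{v} R]

/-- The ring `S` acts on `Ext M N n` by postcomposition when `N` is an `S`-module. -/
noncomputable def extSMulHom (S : Type w) (N : Type v) [CommRing S] [Algebra R S]
    [AddCommGroup N] [Module R N] [Module S N] [IsScalarTower R S N]
    (M : ModuleCat.{v} R) (n : ℕ) :
    S →+* AddMonoid.End (Ext M (ModuleCat.of R N) n) where
  toFun s := (Ext.mk₀ (ModuleCat.ofHom (Algebra.lsmul R R N s))).postcomp M (add_zero n)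
  map_one' := by
    ext e
    have : ModuleCat.ofHom (Algebra.lsmul R R N (1 : S)) = 𝟙 (ModuleCat.of R N) := by
      ext; simp
    change e.comp (Ext.mk₀ _) (add_zero n) = e
    rw [this, Ext.comp_mk₀_id]
  map_mul' s t := by
    ext e
    have : ModuleCat.ofHom (Algebra.lsmul R R N (s * t)) =
        ModuleCat.ofHom (Algebra.lsmul R R N t) ≫ ModuleCat.ofHom (Algebra.lsmul R R N s) := by
      ext; simp
    change e.comp (Ext.mk₀ _) (add_zero n) =
      (e.comp (Ext.mk₀ _) (add_zero n)).comp (Ext.mk₀ _) (add_zero n)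
    rw [this, ← Ext.mk₀_comp_mk₀, Ext.comp_assoc_of_third_deg_zero]
  map_zero' := by
    ext e
    have : ModuleCat.ofHom (Algebra.lsmul R R N (0 : S)) = 0 := by
      ext; simp
    change e.comp (Ext.mk₀ _) (add_zero n) = 0
    rw [this, Ext.mk₀_zero, Ext.comp_zero]
  map_add' s t := by
    ext e
    have : ModuleCat.ofHom (Algebra.lsmul R R N (s + t)) =
        ModuleCat.ofHom (Algebra.lsmul R R N s) + ModuleCat.ofHom (Algebra.lsmul R R N t) := by
      ext; simp
    change e.comp (Ext.mk₀ _) (add_zero n) =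
      e.comp (Ext.mk₀ _) (add_zero n) + e.comp (Ext.mk₀ _) (add_zero n)
    rw [this, Ext.mk₀_add, Ext.comp_add]

/-- The `S`-module structure on `Ext M N n` induced by an `S`-module structure on `N`. -/
noncomputable abbrev extModule (S : Type w) (N : Type v) [CommRing S] [Algebra R S]
    [AddCommGroup N] [Module R N] [Module S N] [IsScalarTower R S N]
    (M : ModuleCat.{v} R) (n : ℕ) : Module S (Ext M (ModuleCat.of R N) n) :=
  Module.compHom _ (extSMulHom S N M n)

lemma extModule_smul_def (M : ModuleCat.{v} R) (n : ℕ) (s : S) (e : Ext M (ModuleCat.of R N) n) :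
    letI := extModule S N M n
    s • e = e.comp (Ext.mk₀ (ModuleCat.ofHom (Algebra.lsmul R R N s))) (add_zero n) := rfl

lemma extModule_algebraMap_smul (M : ModuleCat.{v} R) (n : ℕ) (r : R)
    (e : Ext M (ModuleCat.of R N) n) :
    letI := extModule S N M n
    algebraMap R S r • e = r • e := by
  have : ModuleCat.ofHom (Algebra.lsmul R R N (algebraMap R S r)) =
      r • 𝟙 (ModuleCat.of R N) := by
    ext; simp
  rw [extModule_smul_def, this, Ext.smul_eq_comp_mk₀]

/-- Dimension shifting: the connecting map from Ext of a finite syzygy is surjective and `S`-linear.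
-/
lemma finite_extModule [IsNoetherianRing R] [IsNoetherianRing S] [Module.Finite S N]
    (M : ModuleCat.{v} R) [Module.Finite R M] (n : ℕ) :
    letI := extModule S N M n
    Module.Finite S (Ext M (ModuleCat.of R N) n) := by
  induction n generalizing M with
  | zero =>
    let := extModule S N M 0
    have := Module.Finite.linearMap_of_isNoetherian (R := R) (S := S) (N := N) M
    let φ : (M →ₗ[R] N) →ₗ[S] Ext M (ModuleCat.of R N) 0 :=
      { toFun f := Ext.mk₀ (ModuleCat.ofHom f)
        map_add' f g := by rw [← Ext.mk₀_add]; rfl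
        map_smul' s f := by
          rw [RingHom.id_apply, extModule_smul_def, Ext.mk₀_comp_mk₀]
          rfl }
    refine Module.Finite.of_surjective φ fun e ↦ ?_
    obtain ⟨f, rfl⟩ := (Ext.mk₀_bijective _ _).2 e
    exact ⟨f.hom, rfl⟩
  | succ n ih =>
    obtain ⟨F, _, _, _, _, f, hf⟩ := Module.exists_finite_presentation R M
    have hE := LinearMap.shortExact_shortComplexKer hf
    let := extModule S N f.shortComplexKer.X₁ n
    let := extModule S N M (n + 1)
    have := ih f.shortComplexKer.X₁
    let δ : Ext f.shortComplexKer.X₁ (ModuleCat.of R N) n →ₗ[S]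
        Ext M (ModuleCat.of R N) (n + 1) :=
      { hE.extClass.precomp (ModuleCat.of R N) (add_comm 1 n) with
        map_smul' s e := by
          change hE.extClass.comp (e.comp _ (add_zero n)) (add_comm 1 n) =
            (hE.extClass.comp e (add_comm 1 n)).comp _ (add_zero (n + 1))
          rw [Ext.comp_assoc_of_third_deg_zero] }
    exact Module.Finite.of_surjective δ
      (precomp_extClass_surjective_of_projective_X₂ (ModuleCat.of R N) hE n)

/-- Were the target zero, the long exact sequence would make `x` surjective on a nonzero finite
`S`-module, against Nakayama. -/
lemma nontrivial_ext_quotSMulTop [IsLocalRing R] [IsNoetherianRing R] [IsLocalRing S]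
    [IsNoetherianRing S] [IsLocalHom (algebraMap R S)] [Module.Finite S N]
    (M : ModuleCat.{v} R) [Module.Finite R M] {x : R} (hx : x ∈ maximalIdeal R)
    (reg : IsSMulRegular M x) (n : ℕ) (h : Nontrivial (Ext M (ModuleCat.of R N) n)) :
    Nontrivial (Ext (ModuleCat.of R (QuotSMulTop x M)) (ModuleCat.of R N) (n + 1)) := by
  let := extModule S N M n
  have := finite_extModule (S := S) (N := N) M n
  by_contra! hsub
  have hxS : algebraMap R S x ∈ (Module.annihilator S (Ext M (ModuleCat.of R N) n)).jacobson :=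
    maximalIdeal_le_jacobson _ (map_nonunit (algebraMap R S) x hx)
  refine Submodule.top_ne_pointwise_smul_of_mem_jacobson_annihilator hxS ?_
  rw [eq_comm, eq_top_iff]
  intro y _
  obtain ⟨z, hz⟩ := Ext.contravariant_sequence_exact₁ reg.smulShortComplex_shortExact
    (ModuleCat.of R N) y (add_comm 1 n) (hsub.elim _ _)
  change Ext M (ModuleCat.of R N) n at z
  have hz' : algebraMap R S x • z = y := by
    change (Ext.mk₀ (x • 𝟙 M)).comp z (zero_add n) = y at hz
    rw [extModule_algebraMap_smul, ← hz, Ext.mk₀_smul, Ext.smul_comp, Ext.mk₀_id_comp]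
  rw [← hz']
  exact Submodule.smul_mem_pointwise_smul _ _ ⊤ trivial

lemma nontrivial_ext_quotient_ofList [IsLocalRing R] [IsNoetherianRing R] [IsLocalRing S]
    [IsNoetherianRing S] [IsLocalHom (algebraMap R S)] [Module.Finite S N]
    (rs : List R) (hrs : ∀ r ∈ rs, r ∈ maximalIdeal R)
    (M : ModuleCat.{v} R) [Module.Finite R M] (reg : IsWeaklyRegular M rs) (n : ℕ)
    (h : Nontrivial (Ext M (ModuleCat.of R N) n)) :
    ∃ Q : ModuleCat.{v} R, Nontrivial (Ext Q (ModuleCat.of R N) (n + rs.length)) := by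
  induction rs generalizing M n with
  | nil => exact ⟨M, h⟩
  | cons x rs ih =>
    rw [isWeaklyRegular_cons_iff] at reg
    obtain ⟨Q, hQ⟩ := ih (fun r hr ↦ hrs r (List.mem_cons_of_mem _ hr))
      (ModuleCat.of R (QuotSMulTop x M)) reg.2 (n + 1)
      (nontrivial_ext_quotSMulTop (S := S) M (hrs x List.mem_cons_self) reg.1 n h)
    refine ⟨Q, ?_⟩
    rwa [List.length_cons, ← add_assoc, add_right_comm]

end ExtModule

/-! ### Injective dimension tested on finite modules -/

section Baer

variable {R : Type u} [CommRing R] [Small.{v} R]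

/-- Baer's criterion: the obstruction to extending a map from `I` to `R` lies in Ext^1(R/I, N). -/
lemma ModuleCat.injective_of_subsingleton_ext_one [IsNoetherianRing R] (N : ModuleCat.{v} R)
    (h : ∀ M : ModuleCat.{v} R, Module.Finite R M → Subsingleton (Ext M N 1)) :
    Injective N := by
  rw [← Module.injective_iff_injective_object R N, ← Module.Baer.iff_injective]
  intro I g
  let eI := Shrink.linearEquiv.{v} R I
  let eR := Shrink.linearEquiv.{v} R R
  let f : Shrink.{v} I →ₗ[R] Shrink.{v} R := eR.symm ∘ₗ I.subtype ∘ₗ eI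
  have hf : Function.Injective f :=
    eR.symm.injective.comp (I.injective_subtype.comp eI.injective)
  let T : ShortComplex (ModuleCat.{v} R) :=
    ModuleCat.shortComplexOfCompEqZero _ _ f.exact_map_mkQ_range.linearMap_comp_eq_zero
  have hT : T.ShortExact := ModuleCat.shortComplex_shortExact T
    f.exact_map_mkQ_range hf (Submodule.mkQ_surjective _)
  have : Module.Finite R (Shrink.{v} R) := Module.Finite.equiv eR.symm
  have hX : Subsingleton (Ext T.X₃ N 1) :=
    h (ModuleCat.of R (Shrink.{v} R ⧸ f.range)) inferInstance
  obtain ⟨e, he⟩ := Ext.contravariant_sequence_exact₁ hT N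
    (Ext.mk₀ (ModuleCat.ofHom (g ∘ₗ eI.toLinearMap))) (add_zero 1) (hX.elim _ _)
  obtain ⟨k, rfl⟩ := (Ext.mk₀_bijective _ _).2 e
  rw [Ext.mk₀_comp_mk₀, (Ext.mk₀_bijective _ _).1.eq_iff] at he
  refine ⟨k.hom ∘ₗ eR.symm.toLinearMap, fun x hx ↦ ?_⟩
  have := LinearMap.congr_fun (congrArg ModuleCat.Hom.hom he) (eI.symm ⟨x, hx⟩)
  simpa [T, f] using this

lemma ModuleCat.hasInjectiveDimensionLT_of_forall_finite [IsNoetherianRing R]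
    (N : ModuleCat.{v} R) (n : ℕ)
    (h : ∀ M : ModuleCat.{v} R, Module.Finite R M → Subsingleton (Ext M N n)) :
    HasInjectiveDimensionLT N n := by
  induction n generalizing N with
  | zero =>
    let eR := Shrink.linearEquiv.{v} R R
    have := h (ModuleCat.of R (Shrink.{v} R)) (Module.Finite.equiv eR.symm)
    rw [hasInjectiveDimensionLT_zero_iff_isZero, ModuleCat.isZero_iff_subsingleton]
    refine subsingleton_of_forall_eq 0 fun y ↦ ?_
    have h0 := (Ext.mk₀_bijective _ _).1 (Subsingleton.elim
      (Ext.mk₀ (ModuleCat.ofHom (LinearMap.toSpanSingleton R N y ∘ₗ eR.toLinearMap))) (Ext.mk₀ 0))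
    simpa using LinearMap.congr_fun (congrArg ModuleCat.Hom.hom h0) (eR.symm 1)
  | succ n ih =>
    -- Degree one is Baer's criterion; above it, passing to a cosyzygy lowers the degree.
    match n with
    | 0 =>
      exact injective_iff_hasInjectiveDimensionLT_one.mp (N.injective_of_subsingleton_ext_one h)
    | n + 1 =>
      let ⟨I, _, f, _⟩ := EnoughInjectives.presentation N
      have hE : (ShortComplex.mk f (Limits.cokernel.π f) (Limits.cokernel.condition f)).ShortExact :=
        { exact := ShortComplex.exact_cokernel f }
      refine (hE.hasInjectiveDimensionLT_X₃_iff n ‹_›).mp (ih _ fun M hM ↦ ?_)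
      refine subsingleton_of_forall_eq 0 fun e ↦ ?_
      obtain ⟨e', rfl⟩ := Ext.covariant_sequence_exact₃ M hE e rfl ((h M hM).elim _ _)
      rw [Ext.eq_zero_of_injective e', Ext.zero_comp]

end Baer

/-- If no regular sequence in the maximal ideal properly extends `rs`, then the residue field
embeds into `R ⧸ (rs)`. -/
lemma exists_injective_residueField_of_maximal {R : Type u} [CommRing R] [IsLocalRing R]
    [IsNoetherianRing R] {rs : List R}
    (hrs : ∀ r ∈ rs, r ∈ maximalIdeal R) (reg : IsRegular R rs)
    (hmax : ∀ x ∈ maximalIdeal R, ¬ IsRegular R (rs ++ [x])) :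
    ∃ f : (R ⧸ maximalIdeal R) →ₗ[R] (R ⧸ Ideal.ofList rs), Function.Injective f := by
  by_contra! hinj
  have : Subsingleton ((R ⧸ maximalIdeal R) →ₗ[R] (R ⧸ Ideal.ofList rs)) := by
    refine subsingleton_of_forall_eq 0 fun f ↦ ?_
    by_contra hf
    have : IsSimpleModule R (R ⧸ maximalIdeal R) :=
      isSimpleModule_iff_quot_maximal.mpr
        ⟨_, maximalIdeal.isMaximal R, ⟨.refl R _⟩⟩
    exact hinj f (f.injective_of_ne_zero hf)
  -- Hom(k, R/(rs)) = 0 yields an element of the maximal ideal regular on R/(rs), which would extend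
  -- `rs`.
  obtain ⟨x, hx, hxr⟩ := IsSMulRegular.subsingleton_linearMap_iff.mp this
  rw [Ideal.annihilator_quotient] at hx
  refine hmax x hx (.of_isWeaklyRegular_of_mem_maximalIdeal R ?_ ?_)
  · simpa [-mem_maximalIdeal, or_imp, forall_and, hx] using hrs
  · rw [isWeaklyRegular_append_iff, isWeaklyRegular_singleton_iff]
    refine ⟨reg.1, ?_⟩
    rwa [(Submodule.quotEquivOfEq _ _ (by simp :
      Ideal.ofList rs • (⊤ : Submodule R R) = Ideal.ofList rs)).isSMulRegular_congr]

/-! ### The two inequalities -/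

section Local

variable {R : Type u} {N : Type v} [CommRing R] [IsLocalRing R] [IsNoetherianRing R] [Small.{v} R]
  [AddCommGroup N] [Module R N]

lemma hasInjectiveDimensionLT_of_subsingleton_ext_residueField (S : Type w)
    [CommRing S] [IsLocalRing S] [IsNoetherianRing S] [Algebra R S] [IsLocalHom (algebraMap R S)]
    [Module S N] [IsScalarTower R S N] [Module.Finite S N]
    (d : ℕ)
    [HasInjectiveDimensionLT (ModuleCat.of R N) (d + 1)]
    (h : ∀ k : ModuleCat.{v} R, Nonempty (k ≃ₗ[R] R ⧸ maximalIdeal R) →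
      Subsingleton (Ext k (ModuleCat.of R N) d)) :
    HasInjectiveDimensionLT (ModuleCat.of R N) d := by
  refine ModuleCat.hasInjectiveDimensionLT_of_forall_finite _ d fun M hM ↦ ?_
  suffices ∀ (M : Type v) [AddCommGroup M] [Module R M] (_ : Module.Finite R M),
      Subsingleton (Ext (ModuleCat.of R M) (ModuleCat.of R N) d) from this M hM
  intro M _ _ hM
  induction hM using IsNoetherianRing.induction_on_isQuotientEquivQuotientPrime R with
  | subsingleton M =>
    refine subsingleton_of_forall_eq 0 fun e ↦ ?_
    rw [← e.mk₀_id_comp, (ModuleCat.isZero_of_subsingleton (ModuleCat.of R M)).eq_zero_of_src (𝟙 _),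
      Ext.mk₀_zero, Ext.zero_comp]
  | quotient M p e =>
    by_cases hp : maximalIdeal R ≤ p.1
    · have hpm : p.1 = maximalIdeal R := ((maximalIdeal.isMaximal R).eq_of_le p.2.ne_top hp).symm
      exact h (ModuleCat.of R M) ⟨e.trans (Submodule.quotEquivOfEq _ _ hpm)⟩
    -- Such an `x` is regular on the domain R/p, so nonzero Ext^d would give nonzero Ext^(d+1).
    · obtain ⟨x, hx, hxp⟩ := SetLike.not_le_iff_exists.mp hp
      have reg : IsSMulRegular M x := by
        rw [e.isSMulRegular_congr]
        refine isSMulRegular_iff_right_eq_zero_of_smul.mpr fun y hy ↦ ?_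
        obtain ⟨y, rfl⟩ := Ideal.Quotient.mk_surjective y
        rw [Algebra.smul_def, Ideal.Quotient.algebraMap_eq, ← map_mul,
          Ideal.Quotient.eq_zero_iff_mem] at hy
        exact Ideal.Quotient.eq_zero_iff_mem.mpr ((p.2.mem_or_mem hy).resolve_left hxp)
      by_contra! hM
      have := nontrivial_ext_quotSMulTop (S := S) (ModuleCat.of R M) hx reg d hM
      exact not_subsingleton _ (HasInjectiveDimensionLT.subsingleton (ModuleCat.of R N) (d + 1)
        (d + 1) le_rfl (ModuleCat.of R (QuotSMulTop x M)))
  | exact M₁ M₂ M₃ f g hf hg hfg h₁ h₃ =>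
    let T : ShortComplex (ModuleCat.{v} R) :=
      ModuleCat.shortComplexOfCompEqZero f g hfg.linearMap_comp_eq_zero
    have hT : T.ShortExact := ModuleCat.shortComplex_shortExact T hfg hf hg
    refine subsingleton_of_forall_eq 0 fun e ↦ ?_
    obtain ⟨e', rfl⟩ := Ext.contravariant_sequence_exact₂ hT (ModuleCat.of R N) e (h₁.elim _ _)
    rw [show e' = 0 from h₃.elim _ _, Ext.comp_zero]

lemma length_le_of_hasInjectiveDimensionLT (S : Type w)
    [CommRing S] [IsLocalRing S] [IsNoetherianRing S] [Algebra R S] [IsLocalHom (algebraMap R S)]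
    [Module S N] [IsScalarTower R S N] [Module.Finite S N]
    [Nontrivial N] (d : ℕ) [HasInjectiveDimensionLT (ModuleCat.of R N) (d + 1)] {rs : List R}
    (hrs : ∀ r ∈ rs, r ∈ maximalIdeal R) (reg : IsRegular R rs) : rs.length ≤ d := by
  let eR := Shrink.linearEquiv.{v} R R
  have : Module.Finite R (Shrink.{v} R) := Module.Finite.equiv eR.symm
  have h0 : Nontrivial (Ext (ModuleCat.of R (Shrink.{v} R)) (ModuleCat.of R N) 0) := by
    obtain ⟨y, hy⟩ := exists_ne (0 : N)
    refine ⟨Ext.mk₀ (ModuleCat.ofHom (LinearMap.toSpanSingleton R N y ∘ₗ eR.toLinearMap)),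
      Ext.mk₀ 0, fun h ↦ hy ?_⟩
    simpa using LinearMap.congr_fun
      (congrArg ModuleCat.Hom.hom ((Ext.mk₀_bijective _ _).1 h)) (eR.symm 1)
  obtain ⟨Q, hQ⟩ := nontrivial_ext_quotient_ofList (S := S) rs hrs
    (ModuleCat.of R (Shrink.{v} R)) ((eR.isWeaklyRegular_congr rs).mpr reg.1) 0 h0
  rw [zero_add] at hQ
  by_contra! hlt
  exact not_subsingleton _ (HasInjectiveDimensionLT.subsingleton (ModuleCat.of R N) (d + 1)
    rs.length hlt Q)

lemma le_length_of_maximal (S : Type w)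
    [CommRing S] [IsLocalRing S] [IsNoetherianRing S] [Algebra R S] [IsLocalHom (algebraMap R S)]
    [Module S N] [IsScalarTower R S N] [Module.Finite S N]
    (d : ℕ) [HasInjectiveDimensionLT (ModuleCat.of R N) (d + 1)]
    (hd : ¬ HasInjectiveDimensionLT (ModuleCat.of R N) d) {rs : List R}
    (hrs : ∀ r ∈ rs, r ∈ maximalIdeal R) (reg : IsRegular R rs)
    (hmax : ∀ x ∈ maximalIdeal R, ¬ IsRegular R (rs ++ [x])) : d ≤ rs.length := by
  by_contra! hlt
  refine hd (hasInjectiveDimensionLT_of_subsingleton_ext_residueField (S := S) d fun k ⟨ek⟩ ↦ ?_)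
  obtain ⟨f, hf⟩ := exists_injective_residueField_of_maximal hrs reg hmax
  let eQ := Shrink.linearEquiv.{v} R (R ⧸ Ideal.ofList rs)
  let f' : k →ₗ[R] Shrink.{v} (R ⧸ Ideal.ofList rs) := eQ.symm ∘ₗ f ∘ₗ ek.toLinearMap
  have hf' : Function.Injective f' := eQ.symm.injective.comp (hf.comp ek.injective)
  let T : ShortComplex (ModuleCat.{v} R) :=
    ModuleCat.shortComplexOfCompEqZero _ _ f'.exact_map_mkQ_range.linearMap_comp_eq_zero
  have hT : T.ShortExact := ModuleCat.shortComplex_shortExact T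
    f'.exact_map_mkQ_range hf' (Submodule.mkQ_surjective _)
  have hpd : HasProjectiveDimensionLT T.X₂ d := by
    rw [← projectiveDimension_lt_iff]
    refine (ModuleCat.projectiveDimension_quotient_eq_length.{v} rs reg).trans_lt ?_
    exact_mod_cast hlt
  refine subsingleton_of_forall_eq 0 fun e ↦ ?_
  -- The obstruction to lifting `e` to Ext^d(R/(rs), N) lies in a vanishing Ext^(d+1).
  obtain ⟨e', he'⟩ := Ext.contravariant_sequence_exact₁ hT (ModuleCat.of R N) e (add_comm 1 d)
    (Ext.eq_zero_of_hasInjectiveDimensionLT _ (d + 1) le_rfl)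
  rw [← he', e'.eq_zero_of_hasProjectiveDimensionLT d le_rfl, Ext.comp_zero]

end Local

theorem corollary3p6 {R : Type u} {S : Type v} {N : Type w}
    [CommRing R] [IsLocalRing R] [IsNoetherianRing R]
    [CommRing S] [IsLocalRing S] [IsNoetherianRing S]
    [Algebra R S] [IsLocalHom (algebraMap R S)]
    [AddCommGroup N] [Module R N] [Module S N] [IsScalarTower R S N]
    [Module.Finite S N] [Nontrivial N]
    (hN : moduleInjDim R N ≠ ⊤) :
    moduleInjDim R N = (localRingDepth R : WithBot ℕ∞) := by
  have : Small.{max u w} R := small_max.{w} R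
  have : Module.Finite S (ULift.{u} N) := Module.Finite.equiv ULift.moduleEquiv.symm
  obtain ⟨d, hd⟩ : ∃ d : ℕ, moduleInjDim R N = d := by
    generalize hm : moduleInjDim R N = m at hN
    induction m with
    | bot =>
      rw [moduleInjDim, injectiveDimension_eq_bot_iff, ModuleCat.isZero_iff_subsingleton] at hm
      exact absurd hm (not_subsingleton (ULift.{u} N))
    | coe m =>
      induction m with
      | top => exact absurd rfl hN
      | coe d => exact ⟨d, rfl⟩
  have hle : HasInjectiveDimensionLT (ModuleCat.of R (ULift.{u} N)) (d + 1) :=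
    (injectiveDimension_le_iff _ d).mp hd.le
  have hge : ¬ HasInjectiveDimensionLT (ModuleCat.of R (ULift.{u} N)) d :=
    (injectiveDimension_ge_iff _ d).mp hd.ge
  have hbound (rs : List R) (hrs : ∀ r ∈ rs, r ∈ maximalIdeal R) (reg : IsRegular R rs) :
      rs.length ≤ d :=
    length_le_of_hasInjectiveDimensionLT (S := S) (N := ULift.{u} N) d hrs reg
  have hdepth : localRingDepth R = d := by
    refine le_antisymm (iSup₂_le fun rs hrs ↦ Nat.cast_le.mpr (hbound rs hrs.1 hrs.2)) ?_
    -- Since lengths are bounded by `d`, a longest regular sequence exists; it admits no extension.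
    let P (n : ℕ) : Prop := ∃ rs : List R, (∀ r ∈ rs, r ∈ maximalIdeal R) ∧ IsRegular R rs ∧
      rs.length = n
    have hP0 : P 0 := ⟨[], by simp, .nil R R, rfl⟩
    classical
    obtain ⟨rs, hrs, reg, hlen⟩ : P (Nat.findGreatest P d) :=
      Nat.findGreatest_spec (Nat.zero_le d) hP0
    have hmax : ∀ x ∈ maximalIdeal R, ¬ IsRegular R (rs ++ [x]) := fun x hx hreg ↦ by
      have hmem : ∀ r ∈ rs ++ [x], r ∈ maximalIdeal R := by
        simpa [-mem_maximalIdeal, or_imp, forall_and, hx] using hrs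
      have := Nat.le_findGreatest (P := P) (hbound _ hmem hreg) ⟨_, hmem, hreg, rfl⟩
      rw [List.length_append, List.length_singleton] at this
      omega
    have hd' := le_length_of_maximal (S := S) (N := ULift.{u} N) d hge hrs reg hmax
    exact (Nat.cast_le.mpr hd').trans
      (le_iSup₂_of_le (f := fun (rs : List R) (_ : (∀ r ∈ rs, r ∈ maximalIdeal R) ∧
        IsRegular R rs) ↦ (rs.length : ℕ∞)) rs ⟨hrs, reg⟩ le_rfl)
  rw [hd, hdepth]
  rfl
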